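/- Let $\lambda$ be a cardinal with $\lambda > \operatorname{cf}\lambda = \kappa > \aleph_0$. An inverse $\kappa$-system of abelian groups is a family $\mathcal A = (G_i, h_{i,j})_{i<j<\kappa}$ in which each $G_i$ ($i<\kappa$) is an additive abelian group, each $h_{i,j} : G_j \to G_i$ ($i<j<\kappa$) is a homomorphism, and $h_{i,j}\circ h_{j,k} = h_{i,k}$ for all $i<j<k<\kappa$. For such a system, under pointwise addition, let $$\mathrm{Gr}(\mathcal A) = \{ (a_{i,j})_{i<j<\kappa} : a_{i,j}\in G_i \text{ and } a_{i,k} = a_{i,j} + h_{i,j}(a_{j,k}) \text{ for all } i<j<k<\kappa \},$$ $$\mathrm{Fact}(\mathcal A) = \{ (a_{i,j})_{i<j<\kappa} : \text{there is } y\in\prod_{k<\kappa} G_k \text{ with } a_{i,j} = y_i - h_{i,j}(y_j) \text{ for all } i<j<\kappa \},$$ so that $\mathrm{Fact}(\mathcal A)$ is a subgroup of the abelian group $\mathrm{Gr}(\mathcal A)$; the quotient $\mathrm{Gr}(\mathcal A)/\mathrm{Fact}(\mathcal A)$ is called the quotient limit of $\mathcal A$. (1) For every cardinal $\mu$ with $0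 < \mu \le \lambda$ there is an inverse $\kappa$-system $\mathcal A = (G_i, h_{i,j})_{i<j<\kappa}$ of abelian groups such that $|G_i| < \lambda$ for every $i<\kappa$ and $|\mathrm{Gr}(\mathcal A)/\mathrm{Fact}(\mathcal A)| = \mu$. (2) Suppose in addition that $2^\kappa < \lambda$ and $\theta^{<\kappa} < \lambda$ for every cardinal $\theta < \lambda$, where $\theta^{<\kappa} = \sup\{\theta^{\nu} : \nu < \kappa \text{ a cardinal}\}$. Then for every cardinal $\mu$ with $\lambda < \mu \le \lambda^\kappa$ there is an inverse $\kappa$-system $\mathcal A = (G_i, h_{i,j})_{i<j<\kappa}$ of abelian groups such that $|G_i| < \lambda$ for every $i<\kappa$ and $|\mathrm{Gr}(\mathcal A)/\mathrm{Fact}(\mathcal A)| = \mu$. -/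

import Mathlib

open Cardinal Ordinal

universe u

/-- An inverse `γ`-system of (additive) abelian groups, for an ordinal `γ`: groups `G i` for `i < γ`
and homomorphisms `hom : G j →+ G i` for `i < j < γ` such that `h i j ∘ h j k = h i k` whenever
`i < j < k < γ`. The ordinals `i < γ` are the elements of the well-order `γ.ToType`. -/
structure InverseOrdinalSystem (γ : Ordinal.{u}) where
  /-- the groups of the system -/
  G : γ.ToType → Type u
  /-- every `G i` is an abelian group -/
  [addCommGroup : ∀ i, AddCommGroup (G i)]
  /-- the connecting homomorphisms -/
  hom : ∀ {i j : γ.ToType}, i < j → (G j →+ G i)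
  hom_comp : ∀ {i j k : γ.ToType} (hij : i < j) (hjk : j < k),
    (hom hij).comp (hom hjk) = hom (hij.trans hjk)

attribute [instance] InverseOrdinalSystem.addCommGroup

namespace InverseOrdinalSystem

variable {γ : Ordinal.{u}}

/-- The index pairs `(i, j)` with `i < j < γ`. -/
abbrev Ind (γ : Ordinal.{u}) : Type u := {p : γ.ToType × γ.ToType // p.1 < p.2}

/-- The group, with pointwise operations, of all families `(a i j)` with `a i j ∈ G i`, indexed by
the pairs `i < j < γ`. -/
abbrev Family (A : InverseOrdinalSystem γ) : Type u := ∀ p : Ind γ, A.G p.1.1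

/-- `Gr(A)`: the families `a` such that `a i k = a i j + h i j (a j k)` for all `i < j < k < γ`. -/
def Gr (A : InverseOrdinalSystem γ) : AddSubgroup A.Family where
  carrier := {a | ∀ (i j k : γ.ToType) (hij : i < j) (hjk : j < k),
    a ⟨(i, k), hij.trans hjk⟩ = a ⟨(i, j), hij⟩ + A.hom hij (a ⟨(j, k), hjk⟩)}
  zero_mem' := by
    intro i j k hij hjk
    simp
  add_mem' := by
    intro a b ha hb i j k hij hjk
    simp only [Pi.add_apply, ha i j k hij hjk, hb i j k hij hjk, map_add]
    abel
  neg_mem' := by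
    intro a ha i j k hij hjk
    simp only [Pi.neg_apply, ha i j k hij hjk, map_neg]
    abel

/-- `Fact(A)`: the families `a` for which there is `y ∈ ∏ k < γ, G k` with
`a i j = y i - h i j (y j)` for all `i < j < γ`. -/
def Fact (A : InverseOrdinalSystem γ) : AddSubgroup A.Family where
  carrier := {a | ∃ y : ∀ k : γ.ToType, A.G k, ∀ (i j : γ.ToType) (hij : i < j),
    a ⟨(i, j), hij⟩ = y i - A.hom hij (y j)}
  zero_mem' := ⟨0, by simp⟩
  add_mem' := by
    rintro a b ⟨y, hy⟩ ⟨z, hz⟩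
    refine ⟨y + z, fun i j hij => ?_⟩
    simp only [Pi.add_apply, hy i j hij, hz i j hij, map_add]
    abel
  neg_mem' := by
    rintro a ⟨y, hy⟩
    refine ⟨-y, fun i j hij => ?_⟩
    simp only [Pi.neg_apply, hy i j hij, map_neg]
    abel

theorem fact_le_gr (A : InverseOrdinalSystem γ) : A.Fact ≤ A.Gr := by
  rintro a ⟨y, hy⟩ i j k hij hjk
  have h : A.hom hij (A.hom hjk (y k)) = A.hom (hij.trans hjk) (y k) :=
    DFunLike.congr_fun (A.hom_comp hij hjk) (y k)
  rw [hy, hy, hy, map_sub, h]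
  abel

/-- The quotient limit `Gr(A)/Fact(A)`; the subgroup `Fact(A)` of `Gr(A)` is viewed as a subgroup of
the group `Gr(A)`. -/
abbrev QuotientLimit (A : InverseOrdinalSystem γ) : Type u :=
  A.Gr ⧸ A.Fact.addSubgroupOf A.Gr

end InverseOrdinalSystem

/-! The problem reduces to cardinalities of ordinary inverse limits. Given a system `C` of groups
smaller than `lam`, let level `i` consist of the finitely supported functions on `[i, κ)` with
values in `C.G i` and sum zero. If the sum condition is dropped, every coherent family is uniquely
of the form `y i - h i j (y j)`: the value `y i l` is that of the entry `(i, j)` at `l` for any `j >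
l`, and supports are finite because countable subsets of `κ` are bounded. The sums of the `y i` form
an element of the limit of `C`, which is exactly the obstruction to factoring
(`mk_quotientLimit_zeroSumSystem`).

Limits of sets suffice when they are infinite: free modules over `ZMod 2` do not change the
cardinality of the limit (`mk_limit_free`), since along a coherent family the support sizes
stabilise.

For `μ < lam` a constant system works; for `μ = lam`, an increasing union of `κ` small sets, with
values outside the current set sent to a default. For `μ > lam`, partial functions from `κ` to
`lam`, truncated in domain and range, have `lam ^ κ` branches. A Galvin–Hajnal rank argument
(`exists_mk_below_eq`) finds exactly `μ` of them below a single function, and `belowSystem` realises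
these as a limit. -/

open Filter Set

/-! ### Ranks modulo a filter and the Galvin–Hajnal argument -/

section Rank

variable {K : Type u}

/-- `RankGE l γ f` says that `f` has rank at least `γ` for the relation "`g i < f i` for
`l`-eventually all `i`" between functions into the ordinals. -/
def RankGE (l : Filter K) (γ : Ordinal.{u + 1}) (f : K → Ordinal.{u}) : Prop :=
  ∀ δ < γ, ∃ g : K → Ordinal.{u}, (∀ᶠ i in l, g i < f i) ∧ RankGE l δ g
termination_by γ

theorem rankGE_iff {l : Filter K} {γ : Ordinal.{u + 1}} {f : K → Ordinal.{u}} :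
    RankGE l γ f ↔ ∀ δ < γ, ∃ g : K → Ordinal.{u}, (∀ᶠ i in l, g i < f i) ∧ RankGE l δ g := by
  rw [RankGE]

/-- Countable completeness makes an infinite descending sequence descend at a single index. -/
theorem wellFounded_eventually_lt (l : Filter K) [l.NeBot] [CountableInterFilter l] :
    WellFounded fun g f : K → Ordinal.{u} => ∀ᶠ i in l, g i < f i := by
  rw [wellFounded_iff_isEmpty_descending_chain]
  refine ⟨fun ⟨s, hs⟩ => ?_⟩
  obtain ⟨i, hi⟩ := (eventually_countable_forall.2 hs).exists
  exact (wellFounded_iff_isEmpty_descending_chain.1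
    (wellFounded_lt (α := Ordinal.{u}))).false ⟨fun n => s n i, hi⟩

theorem exists_not_rankGE (l : Filter K) [l.NeBot] [CountableInterFilter l]
    (f : K → Ordinal.{u}) : ∃ γ, ¬ RankGE l γ f := by
  have wf := wellFounded_eventually_lt l
  have : IsWellFounded _ fun g f : K → Ordinal.{u} => ∀ᶠ i in l, g i < f i := ⟨wf⟩
  have key : ∀ f γ, RankGE l γ f →
      γ ≤ IsWellFounded.rank (fun g f : K → Ordinal.{u} => ∀ᶠ i in l, g i < f i) f := by
    intro f
    induction f using wf.induction with
    | _ f ih =>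
      intro γ h
      refine le_of_forall_lt fun δ hδ => ?_
      obtain ⟨g, hg, hr⟩ := rankGE_iff.1 h δ hδ
      exact (ih g hg δ hr).trans_lt (IsWellFounded.rank_lt_of_rel hg)
  exact ⟨_, fun h => (key f _ h).not_gt (Order.lt_succ _)⟩

/-- Witnesses on the two halves are glued piecewise. The contrapositive is what gets used: a rank
bound persists on at least one half. -/
theorem RankGE.of_inter_compl {l : Filter K} {S : Set K} {γ : Ordinal.{u + 1}}
    {f : K → Ordinal.{u}} (h₁ : RankGE (l ⊓ 𝓟 S) γ f) (h₂ : RankGE (l ⊓ 𝓟 Sᶜ) γ f) :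
    RankGE l γ f := by
  classical
  induction γ using WellFoundedLT.induction generalizing f with
  | _ γ ih =>
    refine rankGE_iff.2 fun δ hδ => ?_
    obtain ⟨g₁, hg₁, hr₁⟩ := rankGE_iff.1 h₁ δ hδ
    obtain ⟨g₂, hg₂, hr₂⟩ := rankGE_iff.1 h₂ δ hδ
    have hcongr : ∀ {l' : Filter K} {δ : Ordinal.{u + 1}} {g g' : K → Ordinal.{u}},
        (∀ᶠ i in l', g i = g' i) → RankGE l' δ g → RankGE l' δ g' := by
      intro l' δ g g' hgg h
      refine rankGE_iff.2 fun ε hε => ?_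
      obtain ⟨k, hk, hr⟩ := rankGE_iff.1 h ε hε
      exact ⟨k, by filter_upwards [hk, hgg] with i h1 h2 using h2 ▸ h1, hr⟩
    refine ⟨S.piecewise g₁ g₂, ?_, ih δ hδ (hcongr ?_ hr₁) (hcongr ?_ hr₂)⟩
    · rw [eventually_inf_principal] at hg₁ hg₂
      filter_upwards [hg₁, hg₂] with i h1 h2
      by_cases hi : i ∈ S
      · simpa [hi] using h1 hi
      · simpa [hi] using h2 hi
    · exact eventually_inf_principal.2 (.of_forall fun i hi => by simp [hi])
    · exact eventually_inf_principal.2 (.of_forall fun i hi => by simp [show i ∉ S from hi])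

variable [LinearOrder K] {L : Type u}

/-- The members of `L` whose values are eventually below `f` on `S`. -/
def eventuallyBelow (val : L → K → Ordinal.{u}) (S : Set K) (f : K → Ordinal.{u}) : Set L :=
  {x | ∀ᶠ i in atTop ⊓ 𝓟 S, val x i < f i}

theorem mk_iUnion_le_of_forall_le {ι : Type u} {c : Cardinal.{u}} {s : ι → Set L} (hc : ℵ₀ ≤ c)
    (hι : #ι ≤ c) (hs : ∀ i, #(s i) ≤ c) : #(⋃ i, s i) ≤ c := by
  refine (mk_iUnion_le s).trans ?_
  calc #ι * ⨆ i, #(s i) ≤ c * c := mul_le_mul' hι (ciSup_le' hs)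
    _ = c := mul_eq_self hc

/-- A Galvin–Hajnal argument: for every large enough `μ`, a family of eventually different
functions into the ordinals has a subset of cardinality `μ` which is a union of sets of the form
`{x | ∀ i ∈ S, val x i < f i}` with one and the same `f`. -/
theorem exists_mk_below_eq [Nonempty K] (hK : ∀ s : Set K, s.Countable → BddAbove s)
    {val : L → K → Ordinal.{u}} (hval : ∀ x y, x ≠ y → ∀ᶠ i in atTop, val x i ≠ val y i)
    {μ : Cardinal.{u}} (hμ : ℵ₀ ≤ μ) (h2 : 2 ^ #K ≤ μ) (hL : μ ≤ #L) :
    ∃ (f : K → Ordinal.{u}) (𝒮 : Set (Set K)),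
      #{x : L | ∃ S ∈ 𝒮, ∀ i ∈ S, val x i < f i} = μ := by
  classical
  -- it suffices to find a union of sets `eventuallyBelow`
  suffices h : ∃ (f : K → Ordinal.{u}) (𝒯 : Set (Set K)),
      #(⋃ S : 𝒯, eventuallyBelow val S f) = μ by
    obtain ⟨f, 𝒯, h⟩ := h
    -- Cutting `T` down to its tails turns "eventually" into "everywhere", a condition that can be
    -- tested level by level.
    refine ⟨f, {S | ∃ T ∈ 𝒯, ∃ a, S = T ∩ Ici a}, ?_⟩
    rw [← h]
    congr 2
    ext x
    simp only [mem_ofPred_eq, mem_iUnion, eventuallyBelow, eventually_inf_principal,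
      eventually_atTop, Subtype.exists, exists_prop]
    constructor
    · rintro ⟨_, ⟨T, hT, a, rfl⟩, hx⟩
      exact ⟨T, hT, a, fun i hi hiT => hx i ⟨hiT, hi⟩⟩
    · rintro ⟨T, hT, a, hx⟩
      exact ⟨_, ⟨T, hT, a, rfl⟩, fun i hi => hx i hi.2 hi.1⟩
  have : CountableInterFilter (atTop : Filter K) := by
    refine ⟨fun s hs h => ?_⟩
    simp only [mem_atTop_sets] at h ⊢
    choose! a ha using h
    obtain ⟨b, hb⟩ := hK _ (hs.image a)
    exact ⟨b, fun c hc t ht => ha t ht c ((hb (mem_image_of_mem a ht)).trans hc)⟩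
  have hSet : #(Set K) ≤ μ := by simpa using h2
  -- choose `f` and `S` with `S` of the least possible rank
  let Large : Ordinal.{u + 1} → Prop := fun γ => ∃ (S : Set K) (f : K → Ordinal.{u}),
    μ ≤ #(eventuallyBelow val S f) ∧ ¬ RankGE (atTop ⊓ 𝓟 S) γ f
  have hne : ∃ γ, Large γ := by
    let f₀ : K → Ordinal.{u} := fun i => ⨆ x, Order.succ (val x i)
    obtain ⟨γ, hγ⟩ := exists_not_rankGE atTop f₀
    refine ⟨γ, Set.univ, f₀, ?_, by simpa using hγ⟩
    have : eventuallyBelow val Set.univ f₀ = Set.univ := eq_univ_of_forall fun x =>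
      eventually_inf_principal.2 (.of_forall fun i _ => (Order.lt_succ _).trans_le
        (le_ciSup (f := fun x => Order.succ (val x i)) bddAbove_of_small x))
    rw [this, mk_univ]
    exact hL
  obtain ⟨γ, ⟨S, f, hSf, hγ⟩, hmin⟩ := WellFounded.has_min
    (wellFounded_lt (α := Ordinal.{u + 1})) {γ | Large γ} hne
  -- On `S ∩ T` with `T` in `Pos` the rank of `f` is still below `γ`, so a function below `f` has
  -- smaller rank there, and minimality of `γ` leaves fewer than `μ` members below it.
  let Pos : Set (Set K) := {T | ¬ RankGE (atTop ⊓ 𝓟 (S ∩ T)) γ f}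
  have hPos : ∀ T, T ∈ Pos ∨ Tᶜ ∈ Pos := by
    intro T
    by_contra! hT
    simp only [Pos, mem_ofPred_eq, not_not, ← inf_principal, ← inf_assoc] at hT
    exact hγ (hT.1.of_inter_compl hT.2)
  have hsmall : ∀ T ∈ Pos, ∀ h : K → Ordinal.{u}, (∀ᶠ i in atTop ⊓ 𝓟 S, h i < f i) →
      #(eventuallyBelow val (S ∩ T) h) < μ := by
    intro T hT h hh
    by_contra! hle
    obtain ⟨δ, hδ, H⟩ : ∃ δ < γ, ∀ g : K → Ordinal.{u}, (∀ᶠ i in atTop ⊓ 𝓟 (S ∩ T), g i < f i) →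
        ¬ RankGE (atTop ⊓ 𝓟 (S ∩ T)) δ g := by
      have hT' := hT
      simp only [Pos, mem_ofPred_eq] at hT'
      rw [rankGE_iff] at hT'
      push Not at hT'
      exact hT'
    refine hmin δ ⟨S ∩ T, h, hle, H h (hh.filter_mono ?_)⟩ hδ
    exact inf_le_inf_left _ (principal_mono.2 inter_subset_left)
  rcases hSf.eq_or_lt with heq | hlt
  · refine ⟨f, {S}, ?_⟩
    rw [heq]
    congr 2
    ext x
    simp
  -- More than `μ` members lie below `f`, so some `g` among them avoids both `F` and everything
  -- below a member of `F` on a positive set. The members below this `g` on positive sets number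
  -- exactly `μ`.
  obtain ⟨F, hFsub, hF⟩ := le_mk_iff_exists_subset.1 hSf
  let U : Set L := ⋃ h : F, ⋃ T : Pos, eventuallyBelow val (S ∩ T) (val h)
  have hPosle : #Pos ≤ μ := (mk_set_le Pos).trans hSet
  have hU : #(U ∪ F : Set L) ≤ μ := by
    refine (mk_union_le _ _).trans (add_le_of_le hμ ?_ hF.le)
    refine mk_iUnion_le_of_forall_le hμ hF.le fun h => ?_
    exact mk_iUnion_le_of_forall_le hμ hPosle fun T => (hsmall T T.2 _ (hFsub h.2)).le
  obtain ⟨g, hgB, hgU⟩ : ∃ g ∈ eventuallyBelow val S f, g ∉ U ∪ F := by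
    by_contra! H
    exact (hlt.trans_le (mk_le_mk_of_subset H)).not_ge hU
  simp only [mem_union, not_or] at hgU
  refine ⟨val g, (fun T => S ∩ T) '' Pos, le_antisymm ?_ ?_⟩
  · refine mk_iUnion_le_of_forall_le hμ ((mk_set_le _).trans hSet) ?_
    rintro ⟨_, T, hT, rfl⟩
    exact (hsmall T hT _ hgB).le
  · rw [← hF]
    refine mk_le_mk_of_subset fun h hh => ?_
    -- Otherwise `g` would lie in `U`. Hence `h ≤ g` on a positive set, strictly so by eventual
    -- difference.
    have hT : {i | val g i < val h i} ∉ Pos := by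
      intro hT
      refine hgU.1 (mem_iUnion₂.2 ⟨⟨h, hh⟩, ⟨_, hT⟩, ?_⟩)
      exact eventually_inf_principal.2 (.of_forall fun i hi => hi.2)
    refine mem_iUnion.2 ⟨⟨_, _, (hPos _).resolve_left hT, rfl⟩, ?_⟩
    refine eventually_inf_principal.2 ?_
    have hne : h ≠ g := fun e => hgU.2 (e ▸ hh)
    filter_upwards [hval h g hne] with i hi hi'
    exact lt_of_le_of_ne (not_lt.1 hi'.2) hi

end Rank

/-! ### Quotient limits of zero-sum systems -/

theorem Finsupp.degree_mapRange_addMonoidHom {ι M N : Type*} [AddCommMonoid M] [AddCommMonoid N]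
    (h : M →+ N) (x : ι →₀ M) :
    (Finsupp.mapRange.addMonoidHom h x).degree = h x.degree := by
  induction x using Finsupp.induction_linear with
  | zero => simp
  | add x y hx hy => simp only [map_add, hx, hy]
  | single i m => simp

theorem Set.finite_of_forall_inter_Iio_finite {K : Type*} [LinearOrder K] [NoMaxOrder K]
    (hK : ∀ s : Set K, s.Countable → BddAbove s) {s : Set K}
    (hs : ∀ j, (s ∩ Set.Iio j).Finite) : s.Finite := by
  by_contra hinf
  obtain ⟨t, hts, htinf, htc⟩ : ∃ t ⊆ s, t.Infinite ∧ t.Countable := by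
    let e := Set.Infinite.natEmbedding s hinf
    refine ⟨Set.range fun n => (e n : K), ?_, ?_, Set.countable_range _⟩
    · rintro _ ⟨n, rfl⟩
      exact (e n).2
    · exact Set.infinite_range_of_injective (Subtype.val_injective.comp e.injective)
  obtain ⟨b, hb⟩ := hK t htc
  obtain ⟨j, hj⟩ := exists_gt b
  exact htinf ((hs j).subset fun x hx => ⟨hts hx, (hb hx).trans_lt hj⟩)

namespace InverseOrdinalSystem

variable {γ : Ordinal.{u}}

/-- The inverse limit of an inverse system of abelian groups. -/
def limit (C : InverseOrdinalSystem γ) : AddSubgroup (∀ i, C.G i) where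
  carrier := {c | ∀ (i j : γ.ToType) (hij : i < j), C.hom hij (c j) = c i}
  zero_mem' := by simp
  add_mem' := by
    intro c d hc hd i j hij
    simp [hc i j hij, hd i j hij]
  neg_mem' := by
    intro c hc i j hij
    simp [hc i j hij]

/-- The group of finitely supported `x : γ → C i` with support in `[i, γ)` and zero sum. -/
def zeroSum (C : InverseOrdinalSystem γ) (i : γ.ToType) : AddSubgroup (γ.ToType →₀ C.G i) where
  carrier := {x | (∀ l < i, x l = 0) ∧ x.degree = 0}
  zero_mem' := by simp
  add_mem' := by
    rintro x y ⟨hx, hx'⟩ ⟨hy, hy'⟩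
    exact ⟨fun l hl => by simp [hx l hl, hy l hl], by simp [hx', hy']⟩
  neg_mem' := by
    rintro x ⟨hx, hx'⟩
    exact ⟨fun l hl => by simp [hx l hl], by simp [hx']⟩

/-- The inverse system of the groups `C.zeroSum i`. -/
noncomputable def zeroSumSystem (C : InverseOrdinalSystem γ) : InverseOrdinalSystem γ where
  G i := C.zeroSum i
  hom {i j} hij :=
    ((Finsupp.mapRange.addMonoidHom (C.hom hij)).comp (C.zeroSum j).subtype).codRestrict
      (C.zeroSum i) fun x => ⟨fun l hl => by simp [x.2.1 l (hl.trans hij)], by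
        simp only [AddMonoidHom.comp_apply, Finsupp.degree_mapRange_addMonoidHom]
        rw [show (C.zeroSum j).subtype x = x from rfl, x.2.2, map_zero]⟩
  hom_comp {i j k} hij hjk := by
    ext x l
    exact DFunLike.congr_fun (C.hom_comp hij hjk) (x.1 l)

/-- The value at `l` of the entry of a family in `C.zeroSumSystem`. -/
noncomputable def entry {C : InverseOrdinalSystem γ} (a : C.zeroSumSystem.Family) (p : Ind γ)
    (l : γ.ToType) : C.G p.1.1 :=
  (show C.zeroSum p.1.1 from a p).1 l

theorem mem_gr_zeroSumSystem {C : InverseOrdinalSystem γ} {a : C.zeroSumSystem.Family} :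
    a ∈ C.zeroSumSystem.Gr ↔ ∀ (i j k : γ.ToType) (hij : i < j) (hjk : j < k) (l : γ.ToType),
      entry a ⟨(i, k), hij.trans hjk⟩ l =
        entry a ⟨(i, j), hij⟩ l + C.hom hij (entry a ⟨(j, k), hjk⟩ l) := by
  constructor
  · intro h i j k hij hjk l
    exact congrArg (fun x : C.zeroSum i => x.1 l) (h i j k hij hjk)
  · intro h i j k hij hjk
    exact Subtype.ext (Finsupp.ext fun l => h i j k hij hjk l)

theorem mem_fact_zeroSumSystem {C : InverseOrdinalSystem γ} {a : C.zeroSumSystem.Family} :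
    a ∈ C.zeroSumSystem.Fact ↔ ∃ y : ∀ i, C.zeroSum i, ∀ (i j : γ.ToType) (hij : i < j)
      (l : γ.ToType), entry a ⟨(i, j), hij⟩ l = (y i).1 l - C.hom hij ((y j).1 l) := by
  constructor
  · rintro ⟨y, hy⟩
    exact ⟨y, fun i j hij l => congrArg (fun x : C.zeroSum i => x.1 l) (hy i j hij)⟩
  · rintro ⟨y, hy⟩
    exact ⟨y, fun i j hij => Subtype.ext (Finsupp.ext fun l => hy i j hij l)⟩

/-- The family `c i • (e i - e j)`. -/
noncomputable def limitFamily (C : InverseOrdinalSystem γ) :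
    (∀ i, C.G i) →+ C.zeroSumSystem.Family where
  toFun c p := (⟨Finsupp.single p.1.1 (c p.1.1) - Finsupp.single p.1.2 (c p.1.1), by
      refine ⟨fun l hl => ?_, by simp⟩
      simp [hl.ne', (hl.trans p.2).ne']⟩ : C.zeroSum p.1.1)
  map_zero' := by
    refine funext fun p => Subtype.ext (Finsupp.ext fun l => ?_)
    simp
    rfl
  map_add' c d := by
    refine funext fun p => Subtype.ext (Finsupp.ext fun l => ?_)
    change _ = (Finsupp.single p.1.1 (c p.1.1) - Finsupp.single p.1.2 (c p.1.1) : _ →₀ C.G p.1.1) l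
      + (Finsupp.single p.1.1 (d p.1.1) - Finsupp.single p.1.2 (d p.1.1) : _ →₀ C.G p.1.1) l
    simp only [Pi.add_apply, Finsupp.single_add, Finsupp.sub_apply, Finsupp.add_apply]
    abel

theorem entry_limitFamily (C : InverseOrdinalSystem γ) (c : ∀ i, C.G i) (p : Ind γ)
    (l : γ.ToType) : entry (C.limitFamily c) p l =
      Finsupp.single p.1.1 (c p.1.1) l - Finsupp.single p.1.2 (c p.1.1) l :=
  rfl

theorem entry_sub {C : InverseOrdinalSystem γ} (a b : C.zeroSumSystem.Family) (p : Ind γ)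
    (l : γ.ToType) : entry (a - b) p l = entry a p l - entry b p l :=
  rfl

theorem hom_single {C : InverseOrdinalSystem γ} {c : ∀ i, C.G i} (hc : c ∈ C.limit)
    {i j : γ.ToType} (hij : i < j) (k l : γ.ToType) :
    C.hom hij (Finsupp.single k (c j) l) = Finsupp.single k (c i) l := by
  rw [← hc i j hij, ← Finsupp.mapRange_single (hf := map_zero _), Finsupp.mapRange_apply]

theorem limitFamily_mem_gr {C : InverseOrdinalSystem γ} {c : ∀ i, C.G i} (hc : c ∈ C.limit) :
    C.limitFamily c ∈ C.zeroSumSystem.Gr := by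
  refine mem_gr_zeroSumSystem.2 fun i j k hij hjk l => ?_
  simp only [entry_limitFamily, map_sub, hom_single hc]
  abel

/-- Evaluating at `l` with `j` beyond `l` kills the `j`-terms and forces `y i` to be the point mass
`c i` at `i`; having sum zero, it vanishes. -/
theorem eq_zero_of_limitFamily_mem_fact [NoMaxOrder γ.ToType] {C : InverseOrdinalSystem γ}
    {c : ∀ i, C.G i} (h : C.limitFamily c ∈ C.zeroSumSystem.Fact) : c = 0 := by
  obtain ⟨y, hy⟩ := mem_fact_zeroSumSystem.1 h
  funext i
  have hyi : (y i).1 = Finsupp.single i (c i) := by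
    ext l
    obtain ⟨j, hj⟩ := exists_gt (max i l)
    have hij := (le_max_left i l).trans_lt hj
    have hlj := (le_max_right i l).trans_lt hj
    have h : Finsupp.single i (c i) l - Finsupp.single j (c i) l =
        (y i).1 l - C.hom hij ((y j).1 l) := hy i j hij l
    rw [(y j).2.1 l hlj, map_zero, Finsupp.single_eq_of_ne hlj.ne] at h
    exact sub_left_inj.1 h.symm
  have := (y i).2.2
  rwa [hyi, Finsupp.degree_single] at this

/-- In the system of the groups of finitely supported functions with support in `[i, γ)`, every
coherent family is trivial. -/
theorem exists_eq_sub_of_mem_gr [NoMaxOrder γ.ToType]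
    (hK : ∀ s : Set γ.ToType, s.Countable → BddAbove s) {C : InverseOrdinalSystem γ}
    {a : C.zeroSumSystem.Family} (ha : a ∈ C.zeroSumSystem.Gr) :
    ∃ y : ∀ i, γ.ToType →₀ C.G i, (∀ i, ∀ l < i, y i l = 0) ∧ ∀ (i j : γ.ToType) (hij : i < j)
      (l : γ.ToType), entry a ⟨(i, j), hij⟩ l = y i l - C.hom hij (y j l) := by
  have hzero : ∀ (p : Ind γ) (l : γ.ToType), l < p.1.1 → entry a p l = 0 := fun p l hl =>
    (show C.zeroSum p.1.1 from a p).2.1 l hl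
  -- The entry at `(j, k)` is supported in `[j, γ)`, so it contributes nothing at `l < j`.
  have hindep : ∀ (i j k l : γ.ToType) (hij : i < j) (hik : i < k), l < j → l < k →
      entry a ⟨(i, j), hij⟩ l = entry a ⟨(i, k), hik⟩ l := by
    have aux : ∀ (i j k l : γ.ToType) (hij : i < j) (hjk : j < k), l < j →
        entry a ⟨(i, j), hij⟩ l = entry a ⟨(i, k), hij.trans hjk⟩ l := by
      intro i j k l hij hjk hlj
      rw [mem_gr_zeroSumSystem.1 ha i j k hij hjk l, hzero ⟨(j, k), hjk⟩ l hlj, map_zero, add_zero]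
    intro i j k l hij hik hj hk
    rcases lt_trichotomy j k with h | rfl | h
    · exact aux i j k l hij h hj
    · rfl
    · exact (aux i k j l hik h hk).symm
  choose s hs using fun i l : γ.ToType => exists_gt (max i l)
  have hsi := fun i l => (le_max_left i l).trans_lt (hs i l)
  have hsl := fun i l => (le_max_right i l).trans_lt (hs i l)
  let y : ∀ i, γ.ToType → C.G i := fun i l => entry a ⟨(i, s i l), hsi i l⟩ l
  -- Below any `j`, the function `y i` agrees with a single finitely supported entry.
  have hfin : ∀ i, (Function.support (y i)).Finite := by
    refine fun i => Set.finite_of_forall_inter_Iio_finite hK fun j => ?_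
    obtain ⟨k, hk⟩ := exists_gt (max i j)
    have hik := (le_max_left i j).trans_lt hk
    refine (show C.zeroSum i from a ⟨(i, k), hik⟩).1.hasFiniteSupport.subset ?_
    rintro l ⟨hl, hlj⟩
    have := hindep i (s i l) k l (hsi i l) hik (hsl i l)
      ((show l < j from hlj).trans ((le_max_right i j).trans_lt hk))
    exact fun h => hl (this.trans h)
  refine ⟨fun i => Finsupp.ofSupportFinite (y i) (hfin i), fun i l hl => hzero _ l hl,
    fun i j hij l => ?_⟩
  obtain ⟨k, hk⟩ := exists_gt (max j l)
  have hjk := (le_max_left j l).trans_lt hk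
  have hlk := (le_max_right j l).trans_lt hk
  change _ = y i l - C.hom hij (y j l)
  rw [show y i l = _ from hindep i _ k l _ (hij.trans hjk) (hsl i l) hlk,
    show y j l = _ from hindep j _ k l _ hjk (hsl j l) hlk, mem_gr_zeroSumSystem.1 ha i j k hij hjk l]
  abel

theorem exists_limitFamily_sub_mem_fact [NoMaxOrder γ.ToType]
    (hK : ∀ s : Set γ.ToType, s.Countable → BddAbove s) {C : InverseOrdinalSystem γ}
    {a : C.zeroSumSystem.Family} (ha : a ∈ C.zeroSumSystem.Gr) :
    ∃ c ∈ C.limit, a - C.limitFamily c ∈ C.zeroSumSystem.Fact := by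
  obtain ⟨y, hy0, hy⟩ := exists_eq_sub_of_mem_gr hK ha
  -- Each entry of `a` has sum zero, so the sums of `y i` and of the image of `y j` agree.
  -- Subtracting the point mass of that sum at `i` then puts `y i` into the zero-sum group.
  have hlim : (fun i => (y i).degree) ∈ C.limit := by
    intro i j hij
    have h1 : (show C.zeroSum i from a ⟨(i, j), hij⟩).1 =
        y i - Finsupp.mapRange.addMonoidHom (C.hom hij) (y j) :=
      Finsupp.ext fun l => hy i j hij l
    have h2 := (show C.zeroSum i from a ⟨(i, j), hij⟩).2.2
    rw [h1, map_sub, Finsupp.degree_mapRange_addMonoidHom, sub_eq_zero] at h2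
    exact h2.symm
  have hmem : ∀ i, y i - Finsupp.single i (y i).degree ∈ C.zeroSum i := fun i =>
    ⟨fun l hl => by simp [hy0 i l hl, hl.ne'], by simp⟩
  refine ⟨_, hlim, mem_fact_zeroSumSystem.2 ⟨fun i => ⟨_, hmem i⟩, fun i j hij l => ?_⟩⟩
  have h := hom_single hlim hij j l
  have h' := hy i j hij l
  change entry a ⟨(i, j), hij⟩ l -
      (Finsupp.single i (y i).degree l - Finsupp.single j (y i).degree l) =
    (y i l - Finsupp.single i (y i).degree l) -
      C.hom hij (y j l - Finsupp.single j (y j).degree l)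
  rw [map_sub, h, h']
  abel

/-- The quotient limit of `C.zeroSumSystem` is in bijection with the limit of `C`. -/
theorem mk_quotientLimit_zeroSumSystem [NoMaxOrder γ.ToType]
    (hK : ∀ s : Set γ.ToType, s.Countable → BddAbove s) (C : InverseOrdinalSystem γ) :
    #C.zeroSumSystem.QuotientLimit = #C.limit := by
  let φ : C.limit → C.zeroSumSystem.QuotientLimit := fun c =>
    QuotientAddGroup.mk ⟨C.limitFamily c.1, limitFamily_mem_gr c.2⟩
  refine (mk_congr (Equiv.ofBijective φ ⟨fun c d hcd => ?_, fun q => ?_⟩)).symm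
  · have h := QuotientAddGroup.eq.1 hcd
    have h' : -C.limitFamily c.1 + C.limitFamily d.1 ∈ C.zeroSumSystem.Fact := h
    rw [neg_add_eq_sub, ← map_sub] at h'
    exact Subtype.ext (sub_eq_zero.1 (eq_zero_of_limitFamily_mem_fact h')).symm
  · obtain ⟨⟨a, ha⟩, rfl⟩ := QuotientAddGroup.mk_surjective q
    obtain ⟨c, hc, h⟩ := exists_limitFamily_sub_mem_fact hK ha
    refine ⟨⟨c, hc⟩, QuotientAddGroup.eq.2 ?_⟩
    change -C.limitFamily c + a ∈ C.zeroSumSystem.Fact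
    rwa [neg_add_eq_sub]

end InverseOrdinalSystem

/-! ### Inverse systems of sets and their free modules -/

theorem Cardinal.mk_finsupp_le (α β : Type u) [Infinite α] [Zero β] :
    #(α →₀ β) ≤ max #α #β := by
  rcases subsingleton_or_nontrivial β with h | h
  · have : #(α →₀ β) ≤ 1 := le_one_iff_subsingleton.2 inferInstance
    exact this.trans ((one_le_aleph0.trans (aleph0_le_mk α)).trans (le_max_left _ _))
  · rw [mk_finsupp_of_infinite]

theorem Cardinal.mk_finsupp_zmod_two (α : Type u) [Infinite α] : #(α →₀ ZMod 2) = #α := by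
  have h : (2 : Cardinal.{u}) ≤ #α := (ofNat_lt_aleph0 (n := 2)).le.trans (aleph0_le_mk α)
  rw [mk_finsupp_lift_of_infinite]
  simpa using h

/-- An inverse system of sets over `K`. -/
structure InverseSetSystem (K : Type u) [LinearOrder K] where
  /-- the sets of the system -/
  Q : K → Type u
  /-- the connecting maps -/
  proj : ∀ {i j : K}, i ≤ j → Q j → Q i
  proj_refl : ∀ (i : K) (x : Q i), proj le_rfl x = x
  proj_proj : ∀ {i j k : K} (hij : i ≤ j) (hjk : j ≤ k) (x : Q k),
    proj hij (proj hjk x) = proj (hij.trans hjk) x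

namespace InverseSetSystem

section

variable {K : Type u} [LinearOrder K]

/-- The inverse limit of an inverse system of sets. -/
def Limit (S : InverseSetSystem K) : Type u :=
  {x : ∀ i, S.Q i // ∀ (i j : K) (hij : i ≤ j), S.proj hij (x j) = x i}

end

theorem _root_.exists_forall_ge_eq_of_monotone_nat {K : Type u} [LinearOrder K] [Nonempty K]
    (hK : ∀ s : Set K, s.Countable → BddAbove s) {n : K → ℕ} (hn : Monotone n) :
    ∃ i₀, ∀ i, i₀ ≤ i → n i = n i₀ := by
  have hinv : ∀ m ∈ Set.range n, ∃ i, n i = m := fun m hm => hm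
  choose! g hg using hinv
  obtain ⟨b, hb⟩ := hK (g '' Set.range n) ((Set.to_countable _).image g)
  refine ⟨b, fun i hi => le_antisymm ?_ (hn hi)⟩
  rw [← hg (n i) ⟨i, rfl⟩]
  exact hn (hb ⟨_, ⟨i, rfl⟩, rfl⟩)

variable {γ : Ordinal.{u}}

/-- The inverse system of the free modules over `ZMod 2` on the sets of a system. -/
noncomputable def free (S : InverseSetSystem γ.ToType) : InverseOrdinalSystem γ where
  G i := S.Q i →₀ ZMod 2
  hom {i j} hij := Finsupp.mapDomain.addMonoidHom (S.proj hij.le)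
  hom_comp {i j k} hij hjk := by
    ext x : 1
    refine AddMonoidHom.ext fun m => ?_
    simp [Finsupp.mapDomain_single, S.proj_proj]

theorem mem_limit_free {S : InverseSetSystem γ.ToType} {c : ∀ i, S.Q i →₀ ZMod 2} :
    c ∈ S.free.limit ↔
      ∀ (i j : γ.ToType) (hij : i < j), (c j).mapDomain (S.proj hij.le) = c i :=
  Iff.rfl

theorem mapDomain_of_le {S : InverseSetSystem γ.ToType} {c : ∀ i, S.Q i →₀ ZMod 2}
    (hc : c ∈ S.free.limit) {i j : γ.ToType} (hij : i ≤ j) :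
    (c j).mapDomain (S.proj hij) = c i := by
  rcases hij.eq_or_lt with rfl | h
  · have : S.proj hij = id := funext fun x => S.proj_refl i x
    rw [this, Finsupp.mapDomain_id]
  · exact mem_limit_free.1 hc i j h

/-- The map from the free module on the limit to the limit of the free modules. -/
noncomputable def freeLimitMap (S : InverseSetSystem γ.ToType) (x : S.Limit →₀ ZMod 2) :
    S.free.limit :=
  ⟨fun i => x.mapDomain fun b => b.1 i, mem_limit_free.2 fun i j hij => by
    rw [← Finsupp.mapDomain_comp]
    congr 1
    exact funext fun b => b.2 i j hij.le⟩

/-- Support sizes grow with the index, hence are constant from some `i₀` on. Past `i₀` the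
projections are bijections between supports, so each point of the support at `i₀` spans one branch.
-/
theorem freeLimitMap_surjective [Nonempty γ.ToType]
    (hK : ∀ s : Set γ.ToType, s.Countable → BddAbove s) (S : InverseSetSystem γ.ToType) :
    Function.Surjective S.freeLimitMap := by
  classical
  rintro ⟨c, hc⟩
  change ∀ i, S.Q i →₀ ZMod 2 at c
  have hsub : ∀ {i j : γ.ToType} (hij : i ≤ j),
      (c i).support ⊆ (c j).support.image (S.proj hij) := fun {i j} hij => by
    rw [← mapDomain_of_le hc hij]
    exact Finsupp.mapDomain_support
  obtain ⟨i₀, hi₀⟩ := exists_forall_ge_eq_of_monotone_nat hK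
    (n := fun i => (c i).support.card)
    fun i j hij => (Finset.card_le_card (hsub hij)).trans Finset.card_image_le
  have hinj : ∀ {j : γ.ToType} (hj : i₀ ≤ j), Set.InjOn (S.proj hj) (c j).support := fun {j} hj =>
    Finset.card_image_iff.1 (le_antisymm Finset.card_image_le
      ((hi₀ j hj).le.trans (Finset.card_le_card (hsub hj))))
  have himage : ∀ {i j : γ.ToType} (_ : i₀ ≤ i) (hij : i ≤ j),
      (c j).support.image (S.proj hij) = (c i).support := fun {i j} hi hij =>
    (Finset.eq_of_subset_of_card_le (hsub hij) (Finset.card_image_le.trans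
      ((hi₀ j (hi.trans hij)).trans (hi₀ i hi).symm).le)).symm
  -- the branch through a point of the support at `i₀`
  have hlift : ∀ (q : (c i₀).support) (j : γ.ToType), ∃ x : S.Q (max i₀ j),
      x ∈ (c (max i₀ j)).support ∧ S.proj (le_max_left i₀ j) x = q := fun q j => by
    have := hsub (le_max_left i₀ j) q.2
    simpa using this
  choose b hb hbq using hlift
  have hcompat : ∀ (q : (c i₀).support) (i j : γ.ToType) (hij : i ≤ j),
      S.proj (max_le_max_left i₀ hij) (b q j) = b q i := by
    intro q i j hij
    refine hinj (le_max_left i₀ i) ?_ (hb q i) ?_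
    · rw [← himage (le_max_left i₀ i) (max_le_max_left i₀ hij)]
      exact Finset.mem_coe.2 (Finset.mem_image_of_mem _ (hb q j))
    · rw [S.proj_proj, hbq, hbq]
  let B : (c i₀).support → S.Limit := fun q =>
    ⟨fun j => S.proj (le_max_right i₀ j) (b q j), fun i j hij => by
      change S.proj hij (S.proj _ (b q j)) = S.proj _ (b q i)
      rw [S.proj_proj, ← hcompat q i j hij, S.proj_proj]⟩
  refine ⟨∑ q : (c i₀).support, Finsupp.single (B q) (c i₀ q), Subtype.ext (funext fun i => ?_)⟩
  change Finsupp.mapDomain _ _ = c i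
  rw [Finsupp.mapDomain_finsetSum]
  simp only [Finsupp.mapDomain_single]
  have hval : ∀ q : (c i₀).support, c (max i₀ i) (b q i) = c i₀ q := by
    intro q
    have h := DFunLike.congr_fun (mapDomain_of_le hc (le_max_left i₀ i)) (q : S.Q i₀)
    rw [← h, ← hbq q i, Finsupp.mapDomain, Finsupp.sum, Finsupp.finsetSum_apply,
      Finset.sum_eq_single_of_mem _ (hb q i), Finsupp.single_eq_same]
    intro x hx hne
    exact Finsupp.single_eq_of_ne fun h => hne (hinj (le_max_left i₀ i) hx (hb q i) h.symm)
  rw [← mapDomain_of_le hc (le_max_right i₀ i), Finsupp.mapDomain, Finsupp.sum]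
  refine Finset.sum_bij (fun q _ => b q i) (fun q _ => hb q i) ?_ ?_ ?_
  · intro q _ q' _ h
    refine Subtype.ext ?_
    rw [← hbq q i, ← hbq q' i, h]
  · intro x hx
    have hx' : S.proj (le_max_left i₀ i) x ∈ (c i₀).support := by
      rw [← himage le_rfl (le_max_left i₀ i)]
      exact Finset.mem_image_of_mem _ hx
    exact ⟨⟨_, hx'⟩, Finset.mem_univ _, hinj (le_max_left i₀ i) (hb _ i) hx (hbq _ i)⟩
  · intro q _
    rw [hval]

theorem mk_limit_free [Nonempty γ.ToType]
    (hK : ∀ s : Set γ.ToType, s.Countable → BddAbove s) (S : InverseSetSystem γ.ToType)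
    (hS : ℵ₀ ≤ #S.Limit) : #S.free.limit = #S.Limit := by
  have : Infinite S.Limit := infinite_iff.2 hS
  refine le_antisymm ?_ ?_
  · refine (mk_le_of_surjective (freeLimitMap_surjective hK S)).trans ?_
    rw [mk_finsupp_zmod_two]
  · refine mk_le_of_injective (f := fun b => S.freeLimitMap (Finsupp.single b 1)) fun b b' h => ?_
    refine Subtype.ext (funext fun i => ?_)
    have h' : (Finsupp.single b (1 : ZMod 2)).mapDomain (fun b => b.1 i) =
        (Finsupp.single b' (1 : ZMod 2)).mapDomain (fun b => b.1 i) :=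
      congrFun (congrArg Subtype.val h) i
    rw [Finsupp.mapDomain_single, Finsupp.mapDomain_single] at h'
    exact Finsupp.single_left_injective one_ne_zero h'

end InverseSetSystem

namespace InverseSetSystem

/-! ### Systems of truncated partial functions -/

section Trunc

variable {J Λ : Type u}

open Classical in
/-- The restriction of a partial function to the arguments in `d` with values in `v`. -/
noncomputable def trunc (d : Set J) (v : Set Λ) (x : J → Option Λ) (a : J) : Option Λ :=
  if a ∈ d ∧ ∃ w ∈ v, x a = some w then x a else none

theorem trunc_eq_some {d : Set J} {v : Set Λ} {x : J → Option Λ} {a : J} {w : Λ} :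
    trunc d v x a = some w ↔ x a = some w ∧ a ∈ d ∧ w ∈ v := by
  unfold trunc
  constructor
  · intro h
    split_ifs at h with h'
    obtain ⟨ha, w', hw', hx⟩ := h'
    have : w' = w := Option.some_injective _ (hx.symm.trans h)
    exact ⟨h, ha, this ▸ hw'⟩
  · rintro ⟨hx, ha, hw⟩
    rw [if_pos ⟨ha, w, hw, hx⟩, hx]

variable {K : Type u} [LinearOrder K]

/-- The inverse system of the partial functions with domain included in `D i` and range included in
`V i`. -/
noncomputable def truncSystem {D : K → Set J} {V : K → Set Λ} (hD : Monotone D)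
    (hV : Monotone V) : InverseSetSystem K where
  Q i := {x : J → Option Λ // ∀ a w, x a = some w → a ∈ D i ∧ w ∈ V i}
  proj {i _} _ x := ⟨trunc (D i) (V i) x.1, fun _ _ h => (trunc_eq_some.1 h).2⟩
  proj_refl i x := by
    refine Subtype.ext (funext fun a => Option.ext fun w => ?_)
    exact trunc_eq_some.trans ⟨fun h => h.1, fun h => ⟨h, x.2 a w h⟩⟩
  proj_proj {i j k} hij hjk x := by
    refine Subtype.ext (funext fun a => Option.ext fun w => ?_)
    refine (trunc_eq_some.trans (and_congr_left' trunc_eq_some)).trans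
      (Iff.trans ?_ trunc_eq_some.symm)
    exact ⟨fun h => ⟨h.1.1, h.2⟩, fun h => ⟨⟨h.1, hD hij h.2.1, hV hij h.2.2⟩, h.2⟩⟩

variable {D : K → Set J} {V : K → Set Λ} {hD : Monotone D} {hV : Monotone V}

theorem mk_truncSystem_le (i : K) :
    #((truncSystem hD hV).Q i) ≤ (#(V i) + 1) ^ #(D i) := by
  have : (#(V i) + 1) ^ #(D i) = #(D i → Option (V i)) := by simp
  rw [this]
  refine mk_le_of_injective (f := fun x a =>
    (x.1 a).pmap (fun v hv => (⟨v, hv⟩ : V i)) fun v h => (x.2 a v h).2) fun x y hxy => ?_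
  refine Subtype.ext (funext fun a => ?_)
  by_cases ha : a ∈ D i
  · have h := congrArg (Option.map Subtype.val) (congrFun hxy ⟨a, ha⟩)
    simpa [Option.map_pmap] using h
  · have : ∀ z : (truncSystem hD hV).Q i, z.1 a = none := fun z =>
      Option.eq_none_iff_forall_ne_some.2 fun w hw => ha (z.2 a w hw).1
    rw [this, this]

theorem mk_limit_truncSystem [Nonempty K] (hD' : ∀ a, ∃ i, a ∈ D i) (hV' : ∀ w, ∃ i, w ∈ V i) :
    #(truncSystem hD hV).Limit = (#Λ + 1) ^ #J := by
  have : (#Λ + 1) ^ #J = #(J → Option Λ) := by simp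
  rw [this]
  let φ : (J → Option Λ) → (truncSystem hD hV).Limit := fun x =>
    ⟨fun i => ⟨trunc (D i) (V i) x, fun _ _ h => (trunc_eq_some.1 h).2⟩, fun i j hij => by
      refine Subtype.ext (funext fun a => Option.ext fun w => ?_)
      refine (trunc_eq_some.trans (and_congr_left' trunc_eq_some)).trans
        (Iff.trans ?_ trunc_eq_some.symm)
      exact ⟨fun h => ⟨h.1.1, h.2⟩, fun h => ⟨⟨h.1, hD hij h.2.1, hV hij h.2.2⟩, h.2⟩⟩⟩
  have hφ : ∀ x i a w, ((φ x).1 i).1 a = some w ↔ x a = some w ∧ a ∈ D i ∧ w ∈ V i :=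
    fun x i a w => trunc_eq_some
  refine (mk_congr (Equiv.ofBijective φ ⟨fun x y hxy => ?_, fun t => ?_⟩)).symm
  · have key : ∀ x y, φ x = φ y → ∀ a w, x a = some w → y a = some w := by
      intro x y hxy a w h
      obtain ⟨i, hi⟩ := hD' a
      obtain ⟨j, hj⟩ := hV' w
      have hx := (hφ x (max i j) a w).2 ⟨h, hD (le_max_left i j) hi, hV (le_max_right i j) hj⟩
      rw [hxy] at hx
      exact ((hφ y _ a w).1 hx).1
    exact funext fun a => Option.ext fun w => ⟨key x y hxy a w, key y x hxy.symm a w⟩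
  · have ht : ∀ {i j : K} (hij : i ≤ j) (a : J) (w : Λ),
        (t.1 i).1 a = some w ↔ (t.1 j).1 a = some w ∧ a ∈ D i ∧ w ∈ V i := by
      intro i j hij a w
      rw [← t.2 i j hij]
      exact trunc_eq_some
    -- Truncation never alters a value, only erases it, so the levels at which `t` is defined at `a`
    -- agree.
    have hex : ∀ a, ∃ o : Option Λ, ∀ w, o = some w ↔ ∃ i, (t.1 i).1 a = some w := by
      intro a
      by_cases h : ∃ i w, (t.1 i).1 a = some w
      · obtain ⟨i, w, hw⟩ := h
        refine ⟨some w, fun w' => ⟨fun e => ⟨i, hw.trans e⟩, ?_⟩⟩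
        rintro ⟨j, hj⟩
        rw [← ((ht (le_max_left i j) a w).1 hw).1, ((ht (le_max_right i j) a w').1 hj).1]
      · push Not at h
        exact ⟨none, fun w => ⟨fun e => by simp at e, fun ⟨i, hi⟩ => (h i w hi).elim⟩⟩
    choose x hx using hex
    refine ⟨x, Subtype.ext (funext fun i => Subtype.ext (funext fun a =>
      Option.ext fun w => ?_))⟩
    rw [hφ, hx]
    constructor
    · rintro ⟨⟨j, hj⟩, ha, hw⟩
      exact (ht (le_max_left i j) a w).2 ⟨((ht (le_max_right i j) a w).1 hj).1, ha, hw⟩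
    · intro h
      exact ⟨⟨i, h⟩, (t.1 i).2 a w h⟩

end Trunc

/-! ### Cutting a limit down to a prescribed cardinality -/

section Below

variable {K : Type u} [LinearOrder K]

/-- The disjoint sum over `T ∈ 𝒮` of the subsystems of `S` given by the points whose restrictions
have `e`-value below `f` at the indices in `T`. -/
def belowSystem (S : InverseSetSystem K) (e : ∀ i, S.Q i → Ordinal.{u}) (f : K → Ordinal.{u})
    (𝒮 : Set (Set K)) : InverseSetSystem K where
  Q i := {p : 𝒮 × S.Q i // ∀ (j : K) (h : j ≤ i), j ∈ p.1.1 → e j (S.proj h p.2) < f j}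
  proj {i j} hij p := ⟨(p.1.1, S.proj hij p.1.2), fun k hk hkT => by
    rw [S.proj_proj]
    exact p.2 k (hk.trans hij) hkT⟩
  proj_refl i p := Subtype.ext (Prod.ext rfl (S.proj_refl i p.1.2))
  proj_proj hij hjk p := Subtype.ext (Prod.ext rfl (S.proj_proj hij hjk p.1.2))

theorem mk_belowSystem_le (S : InverseSetSystem K) (e : ∀ i, S.Q i → Ordinal.{u})
    (f : K → Ordinal.{u}) (𝒮 : Set (Set K)) (i : K) :
    #((S.belowSystem e f 𝒮).Q i) ≤ 2 ^ #K * #(S.Q i) := by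
  refine (mk_subtype_le _).trans ?_
  rw [mk_prod, Cardinal.lift_id, Cardinal.lift_id]
  exact mul_le_mul_left ((mk_set_le _).trans (mk_set).le) _

/-- The tag `T` is constant along a branch, so the limit consists of pairs `(T, x)`. Forgetting the
tag is at most `2 ^ #K`-to-one, which does not affect the cardinality. -/
theorem mk_limit_belowSystem [Nonempty K] (S : InverseSetSystem K) (e : ∀ i, S.Q i → Ordinal.{u})
    (f : K → Ordinal.{u}) (𝒮 : Set (Set K))
    (hK : 2 ^ #K ≤ #{x : S.Limit | ∃ T ∈ 𝒮, ∀ i ∈ T, e i (x.1 i) < f i})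
    (hinf : ℵ₀ ≤ #{x : S.Limit | ∃ T ∈ 𝒮, ∀ i ∈ T, e i (x.1 i) < f i}) :
    #(S.belowSystem e f 𝒮).Limit = #{x : S.Limit | ∃ T ∈ 𝒮, ∀ i ∈ T, e i (x.1 i) < f i} := by
  let P := {p : 𝒮 × S.Limit // ∀ i ∈ p.1.1, e i (p.2.1 i) < f i}
  have hP : #(S.belowSystem e f 𝒮).Limit = #P := by
    let φ : P → (S.belowSystem e f 𝒮).Limit := fun p =>
      ⟨fun i => ⟨(p.1.1, p.1.2.1 i), fun j hj hjT => by
        rw [p.1.2.2 j i hj]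
        exact p.2 j hjT⟩, fun i j hij => Subtype.ext (Prod.ext rfl (p.1.2.2 i j hij))⟩
    refine (mk_congr (Equiv.ofBijective φ ⟨fun p q hpq => ?_, fun y => ?_⟩)).symm
    · have h : ∀ i, (p.1.1, p.1.2.1 i) = (q.1.1, q.1.2.1 i) := fun i =>
        congrArg Subtype.val (congrFun (congrArg Subtype.val hpq) i)
      obtain ⟨i⟩ := ‹Nonempty K›
      exact Subtype.ext (Prod.ext (congrArg Prod.fst (h i) :)
        (Subtype.ext (funext fun i => (congrArg Prod.snd (h i) :))))
    · have hy : ∀ i j (hij : i ≤ j), ((y.1 j).1.1, S.proj hij (y.1 j).1.2) = (y.1 i).1 :=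
        fun i j hij => congrArg Subtype.val (y.2 i j hij)
      obtain ⟨i₀⟩ := ‹Nonempty K›
      have hconst : ∀ i, (y.1 i).1.1 = (y.1 i₀).1.1 := fun i =>
        (congrArg Prod.fst (hy i _ (le_max_left i i₀))).symm.trans
          (congrArg Prod.fst (hy i₀ _ (le_max_right i i₀)))
      refine ⟨⟨((y.1 i₀).1.1, ⟨fun i => (y.1 i).1.2, fun i j hij => congrArg Prod.snd (hy i j hij)⟩),
        fun i hi => ?_⟩, Subtype.ext (funext fun i => Subtype.ext (Prod.ext (hconst i).symm rfl))⟩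
      have := (y.1 i).2 i le_rfl (by rw [hconst i]; exact hi)
      rwa [S.proj_refl] at this
  rw [hP]
  refine le_antisymm ?_ ?_
  · have h1 : #P ≤ #(𝒮 × {x : S.Limit | ∃ T ∈ 𝒮, ∀ i ∈ T, e i (x.1 i) < f i}) := by
      refine mk_le_of_injective (f := fun p => (p.1.1, ⟨p.1.2, _, p.1.1.2, p.2⟩)) fun p q h => ?_
      exact Subtype.ext (Prod.ext (congrArg Prod.fst h :)
        (congrArg (fun r => r.2.1) h :))
    refine h1.trans ?_
    rw [mk_prod, Cardinal.lift_id, Cardinal.lift_id]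
    refine (mul_le_mul_left (((mk_set_le _).trans mk_set.le).trans hK) _).trans ?_
    rw [mul_eq_self hinf]
  · refine mk_le_of_surjective (f := fun p : P => ⟨p.1.2, _, p.1.1.2, p.2⟩) ?_
    rintro ⟨x, T, hT, hx⟩
    exact ⟨⟨(⟨T, hT⟩, x), hx⟩, rfl⟩

theorem exists_mk_limit_eq [Nonempty K] (hK : ∀ s : Set K, s.Countable → BddAbove s)
    (S : InverseSetSystem K) {μ : Cardinal.{u}} (hμ : ℵ₀ ≤ μ) (h2 : 2 ^ #K ≤ μ)
    (hS : μ ≤ #S.Limit) :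
    ∃ S' : InverseSetSystem K, (∀ i, #(S'.Q i) ≤ 2 ^ #K * #(S.Q i)) ∧ #S'.Limit = μ := by
  let e : ∀ i, S.Q i → Ordinal.{u} := fun i => typein WellOrderingRel
  have he : ∀ i, Function.Injective (e i) := fun i => typein_injective _
  -- Branches that differ at one level differ at all later ones.
  have hval : ∀ x y : S.Limit, x ≠ y → ∀ᶠ i in atTop, e i (x.1 i) ≠ e i (y.1 i) := by
    intro x y hxy
    obtain ⟨i, hi⟩ : ∃ i, x.1 i ≠ y.1 i := by
      by_contra! h
      exact hxy (Subtype.ext (funext h))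
    filter_upwards [eventually_ge_atTop i] with j hj h
    apply hi
    rw [← x.2 i j hj, ← y.2 i j hj, he j h]
  obtain ⟨f, 𝒮, h⟩ := exists_mk_below_eq hK hval hμ h2 hS
  refine ⟨S.belowSystem e f 𝒮, S.mk_belowSystem_le e f 𝒮, ?_⟩
  rw [← h]
  exact S.mk_limit_belowSystem e f 𝒮 (h2.trans h.ge) (hμ.trans h.ge)

end Below

end InverseSetSystem

/-! ### Cofinality and assembly of the theorem -/

theorem Cardinal.bddAbove_of_countable_ord_toType {κ : Cardinal.{u}} (hκ : ℵ₀ < κ)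
    (hreg : κ.ord.cof = κ) (s : Set κ.ord.ToType) (hs : s.Countable) : BddAbove s := by
  refine BddAbove.of_not_isCofinal fun h => ?_
  have h1 := Order.cof_le h
  rw [cof_toType, hreg] at h1
  exact (h1.trans (le_aleph0_iff_set_countable.2 hs)).not_gt hκ

/-- A set of cardinality `λ` is the union of an increasing `cf λ`-chain of smaller sets. -/
theorem Cardinal.exists_monotone_cover {lam κ : Cardinal.{u}} (hκ : ℵ₀ ≤ κ)
    (hcof : lam.ord.cof = κ) :
    ∃ V : κ.ord.ToType → Set lam.ord.ToType, Monotone V ∧ (∀ w, ∃ i, w ∈ V i) ∧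
      ∀ i, #(V i) < lam := by
  have hcof' : Order.cof lam.ord.ToType = κ := (cof_toType _).trans hcof
  obtain ⟨s, hs, hsκ⟩ := Order.exists_cof_eq lam.ord.ToType
  obtain ⟨e⟩ : Nonempty (κ.ord.ToType ≃ s) := Cardinal.eq.1 (by
    rw [hsκ, hcof', mk_ord_toType])
  -- The enumeration `e` need not be monotone, so all `j ≤ i` are used; being fewer than `κ`, their
  -- images are bounded.
  refine ⟨fun i => {w | ∃ j ≤ i, w ≤ e j}, ?_, fun w => ?_, fun i => ?_⟩
  · rintro i i' h w ⟨j, hj, hw⟩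
    exact ⟨j, hj.trans h, hw⟩
  · obtain ⟨v, hv, hwv⟩ := hs w
    exact ⟨e.symm ⟨v, hv⟩, _, le_rfl, by simpa using hwv⟩
  · have hcard : #((fun j => (e j : lam.ord.ToType)) '' Set.Iic i) < κ := by
      refine mk_image_le.trans_lt ?_
      have h := mk_Iic_lt i (by rw [mk_ord_toType, type_toType]) (by rwa [mk_ord_toType])
      rwa [mk_ord_toType] at h
    obtain ⟨x, hx⟩ := not_isCofinal_iff.1 fun h =>
      (hcard.trans_eq hcof'.symm).not_ge (Order.cof_le h)
    refine (mk_le_mk_of_subset ?_).trans_lt (mk_Iio_toType_ord_lt x)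
    rintro w ⟨j, hj, hw⟩
    exact hw.trans_lt (hx _ (Set.mem_image_of_mem _ hj))

namespace InverseOrdinalSystem

variable {κ : Cardinal.{u}}

theorem exists_mk_quotientLimit_eq_mk_limit (hκ : ℵ₀ < κ) (hreg : κ.ord.cof = κ)
    {lam : Cardinal.{u}} (hlam : κ < lam) (C : InverseOrdinalSystem κ.ord)
    (hC : ∀ i, #(C.G i) < lam) :
    ∃ A : InverseOrdinalSystem κ.ord, (∀ i, #(A.G i) < lam) ∧ #A.QuotientLimit = #C.limit := by
  have : NoMaxOrder κ.ord.ToType := Cardinal.noMaxOrder hκ.le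
  have : Infinite κ.ord.ToType := infinite_iff.2 (by rw [mk_ord_toType]; exact hκ.le)
  refine ⟨C.zeroSumSystem, fun i => ?_,
    mk_quotientLimit_zeroSumSystem (bddAbove_of_countable_ord_toType hκ hreg) C⟩
  refine ((mk_subtype_le _).trans (mk_finsupp_le _ _)).trans_lt (max_lt ?_ (hC i))
  rwa [mk_ord_toType]

theorem exists_mk_quotientLimit_eq_mk_setLimit (hκ : ℵ₀ < κ) (hreg : κ.ord.cof = κ)
    {lam : Cardinal.{u}} (hlam : κ < lam) (S : InverseSetSystem κ.ord.ToType)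
    (hS : ∀ i, #(S.Q i) < lam) (hinf : ℵ₀ ≤ #S.Limit) :
    ∃ A : InverseOrdinalSystem κ.ord, (∀ i, #(A.G i) < lam) ∧ #A.QuotientLimit = #S.Limit := by
  have : Infinite κ.ord.ToType := infinite_iff.2 (by rw [mk_ord_toType]; exact hκ.le)
  rw [← S.mk_limit_free (bddAbove_of_countable_ord_toType hκ hreg) hinf]
  refine exists_mk_quotientLimit_eq_mk_limit hκ hreg hlam _ fun i => ?_
  change #(S.Q i →₀ ZMod 2) < lam
  rcases finite_or_infinite (S.Q i) with h | h
  · have : Finite (S.Q i →₀ ZMod 2) :=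
      Finite.of_injective (fun x : S.Q i →₀ ZMod 2 => (x : S.Q i → ZMod 2)) DFunLike.coe_injective
    exact (lt_aleph0_of_finite (S.Q i →₀ ZMod 2)).trans (hκ.trans hlam)
  · rw [mk_finsupp_zmod_two]
    exact hS i

/-- The constant inverse system. -/
def const (γ : Ordinal.{u}) (G : Type u) [AddCommGroup G] : InverseOrdinalSystem γ where
  G _ := G
  hom _ := AddMonoidHom.id G
  hom_comp _ _ := rfl

theorem mk_limit_const {γ : Ordinal.{u}} [Nonempty γ.ToType] (G : Type u) [AddCommGroup G] :
    #(const γ G).limit = #G := by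
  refine (mk_congr (Equiv.ofBijective
    (fun g : G => (⟨fun _ => g, fun _ _ _ => rfl⟩ : (const γ G).limit)) ⟨fun g g' h => ?_, ?_⟩)).symm
  · obtain ⟨i⟩ := ‹Nonempty γ.ToType›
    exact congrFun (congrArg Subtype.val h) i
  · rintro ⟨c, hc⟩
    have hc' : ∀ i j : γ.ToType, i < j → c j = c i := hc
    obtain ⟨i⟩ := ‹Nonempty γ.ToType›
    refine ⟨c i, Subtype.ext (funext fun j => ?_)⟩
    rcases lt_trichotomy i j with h | rfl | h
    · exact (hc' i j h).symm
    · rfl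
    · exact hc' j i h

end InverseOrdinalSystem

theorem Cardinal.exists_addCommGroup_mk_eq {μ : Cardinal.{u}} (hμ : μ ≠ 0) :
    ∃ (G : Type u) (_ : AddCommGroup G), #G = μ := by
  rcases lt_or_ge μ ℵ₀ with h | h
  · obtain ⟨n, rfl⟩ := lt_aleph0.1 h
    have : NeZero n := ⟨by simpa using hμ⟩
    exact ⟨ULift (ZMod n), inferInstance, by simp⟩
  · induction μ using Cardinal.inductionOn with
    | _ α =>
      have : Infinite α := infinite_iff.2 h
      exact ⟨α →₀ ZMod 2, inferInstance, mk_finsupp_zmod_two α⟩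

theorem mainTheorem1 (lam κ : Cardinal.{u}) (hκ : ℵ₀ < κ) (hcof : lam.ord.cof = κ)
    (hlam : κ < lam) :
    (∀ μ : Cardinal.{u}, μ ≠ 0 → μ ≤ lam →
      ∃ A : InverseOrdinalSystem κ.ord, (∀ i, #(A.G i) < lam) ∧ #A.QuotientLimit = μ) ∧
    (2 ^ κ < lam → (∀ θ : Cardinal.{u}, θ < lam → θ ^< κ < lam) →
      ∀ μ : Cardinal.{u}, lam < μ → μ ≤ lam ^ κ →
        ∃ A : InverseOrdinalSystem κ.ord, (∀ i, #(A.G i) < lam) ∧ #A.QuotientLimit = μ) := by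
  have hreg : κ.ord.cof = κ := by
    rw [← hcof]
    exact cof_ord_cof _
  have hlam0 : ℵ₀ ≤ lam := (hκ.trans hlam).le
  have : NoMaxOrder κ.ord.ToType := Cardinal.noMaxOrder hκ.le
  have : Nonempty κ.ord.ToType := mk_ne_zero_iff.1 (by
    rw [mk_ord_toType]
    exact (aleph0_pos.trans hκ).ne')
  have hK := bddAbove_of_countable_ord_toType hκ hreg
  obtain ⟨V, hV, hVcover, hVlt⟩ := exists_monotone_cover hκ.le hcof
  have hVlt' : ∀ i, #(V i) + 1 < lam := fun i =>
    add_lt_of_lt hlam0 (hVlt i) (one_lt_aleph0.trans_le hlam0)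
  refine ⟨fun μ hμ0 hμ => ?_, fun h2 hpow μ hμ hμle => ?_⟩
  · rcases hμ.lt_or_eq with hμ | rfl
    · obtain ⟨G, _, rfl⟩ := exists_addCommGroup_mk_eq hμ0
      rw [← InverseOrdinalSystem.mk_limit_const (γ := κ.ord) G]
      exact InverseOrdinalSystem.exists_mk_quotientLimit_eq_mk_limit hκ hreg hlam _ fun _ => hμ
    -- A partial function on one point is an element of the target or undefined, so the limit has `μ
    -- + 1 = μ` points.
    · let S := InverseSetSystem.truncSystem
        (monotone_const : Monotone fun _ : κ.ord.ToType => (Set.univ : Set PUnit.{u + 1})) hV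
      have hS : #S.Limit = μ := by
        rw [InverseSetSystem.mk_limit_truncSystem (fun a => ⟨Classical.arbitrary _, mem_univ a⟩)
          hVcover]
        simp [add_one_eq hlam0]
      rw [← hS]
      refine InverseOrdinalSystem.exists_mk_quotientLimit_eq_mk_setLimit hκ hreg (hS ▸ hlam) S
        (fun i => ?_) (hS ▸ hlam0)
      rw [hS]
      refine (InverseSetSystem.mk_truncSystem_le i).trans_lt ?_
      simpa using hVlt' i
  -- Domains of size below `κ` bound each level by some `θ ^< κ` with `θ < lam`.
  · have hD : Monotone fun i : κ.ord.ToType => Set.Iio i := fun _ _ h => Set.Iio_subset_Iio h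
    let S := InverseSetSystem.truncSystem hD hV
    have hSlim : #S.Limit = lam ^ κ := by
      refine (InverseSetSystem.mk_limit_truncSystem (hD := hD) (hV := hV)
        (fun a => exists_gt a) hVcover).trans ?_
      simp [add_one_eq hlam0]
    have hSlt : ∀ i, #(S.Q i) < lam := fun i =>
      ((InverseSetSystem.mk_truncSystem_le i).trans
        (le_powerlt _ (mk_Iio_toType_ord_lt i))).trans_lt (hpow _ (hVlt' i))
    obtain ⟨S', hS', rfl⟩ := S.exists_mk_limit_eq hK (hlam0.trans hμ.le)
      (by rw [mk_ord_toType]; exact (h2.trans hμ).le) (hSlim ▸ hμle)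
    refine InverseOrdinalSystem.exists_mk_quotientLimit_eq_mk_setLimit hκ hreg hlam S'
      (fun i => (hS' i).trans_lt ?_) (hlam0.trans hμ.le)
    rw [mk_ord_toType]
    exact mul_lt_of_lt hlam0 h2 (hSlt i)
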